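/- There are absolute constants $c>0$ and $D$ such that for every integer $n$ and every real $\alpha>2$ with $n/3-1>\alpha$ there is an $n$-point metric space $(X,d_X)$ with the following properties. (i) $(X,d_X)$ is planar: $d_X$ is the shortest path metric of a planar graph with vertex set $X$ and positive edge weights. (ii) $(X,d_X)$ has doubling dimension at most $D$, where the doubling dimension is $\log_2\lambda$ for the least $\lambda$ such that every ball of radius $2r$ in $X$ can be covered by $\lambda$ balls of radius $r$ (for all $r>0$). (iii) Every Ramsey tree cover of $X$ with distortion $\alpha$ consists of at least $n^{c/(\alpha\ln\alpha)}$ trees, i.e. every Ramsey $(\alpha,k)$-tree cover of $X$ satisfies $k\ge n^{c/(\alpha\ln\alpha)}$. Here a Ramsey $(\alpha,k)$-tree cover of $(X,d_X)$ is a collection of $k$ trees $T_1,\dots,T_k$ with nonnegative edge weights and $X\subseteq V(T_i)$ (further vertices are allowed), such that each $T_i$ is dominating, i.e. $d_{T_i}(x,y)\ge d_X(x,y)$ for all $x,y\in X$, and such that for every $u\in X$ there is an $i$ with $d_{T_i}(u,v)\le\alpha\, d_X(u,v)$ for all $v\in X$. Here $d_{T_i}(x,y)$ denotes the length of the path from $x$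 to $y$ in $T_i$. -/

import Mathlib

/-- The length of a walk in a graph whose edges carry real weights. -/
noncomputable def walkLength {V : Type*} {G : SimpleGraph V} (w : Sym2 V → ℝ) {u v : V}
    (p : G.Walk u v) : ℝ :=
  (p.edges.map w).sum

/-- `G` is planar: it can be drawn in the plane with distinct points for the vertices and simple
arcs for the edges. The arc of an edge joins its two endpoints, contains no other vertex, and two
distinct arcs meet only in points that represent a common endpoint of the two edges. -/
def IsPlanarGraph {V : Type*} (G : SimpleGraph V) : Prop :=
  ∃ (pos : V → ℝ × ℝ) (arc : Sym2 V → Set (ℝ × ℝ)),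
    Function.Injective pos ∧
    (∀ u v : V, G.Adj u v →
      ∃ γ : Path (pos u) (pos v), Function.Injective γ ∧ Set.range γ = arc s(u, v)) ∧
    (∀ e ∈ G.edgeSet, ∀ v : V, pos v ∈ arc e → v ∈ e) ∧
    (∀ e ∈ G.edgeSet, ∀ f ∈ G.edgeSet, e ≠ f →
      ∀ z ∈ arc e ∩ arc f, ∃ v : V, v ∈ e ∧ v ∈ f ∧ pos v = z)

/-- The metric of `X` is a planar metric: it is the shortest path metric of a planar graph with
vertex set `X` and positive edge weights. (In particular the graph is connected.) -/
def IsPlanarMetric (X : Type*) [MetricSpace X] : Prop :=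
  ∃ (G : SimpleGraph X) (w : Sym2 X → ℝ),
    IsPlanarGraph G ∧
    (∀ e ∈ G.edgeSet, 0 < w e) ∧
    ∀ x y : X, IsLeast (Set.range fun p : G.Walk x y => walkLength w p) (dist x y)

/-- Every ball of radius `2 * r` in `X` is covered by at most `m` balls of radius `r`. -/
def IsDoublingWith (X : Type*) [MetricSpace X] (m : ℕ) : Prop :=
  ∀ (x : X) (r : ℝ), 0 < r → ∃ s : Finset X, s.card ≤ m ∧
    Metric.closedBall x (2 * r) ⊆ ⋃ y ∈ s, Metric.closedBall y r

/-- The doubling constant: the least `m` such that every ball of radius `2 * r` is covered by `m`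
balls of radius `r`. For a finite metric space such an `m` exists. -/
noncomputable def doublingConstant (X : Type*) [MetricSpace X] : ℕ :=
  sInf {m : ℕ | IsDoublingWith X m}

/-- On a finite metric space the infimum defining the doubling constant is attained. -/
theorem isDoublingWith_doublingConstant (X : Type*) [MetricSpace X] [Fintype X] :
    IsDoublingWith X (doublingConstant X) := by
  have h : {m : ℕ | IsDoublingWith X m}.Nonempty := by
    refine ⟨Fintype.card X, fun x r hr => ⟨Finset.univ, le_rfl, fun y _ => ?_⟩⟩
    simp only [Set.mem_iUnion]
    exact ⟨y, Finset.mem_univ y, Metric.mem_closedBall_self hr.le⟩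
  exact Nat.sInf_mem h

/-- The doubling dimension: the binary logarithm of the doubling constant. -/
noncomputable def doublingDimension (X : Type*) [MetricSpace X] : ℝ :=
  Real.logb 2 (doublingConstant X)

/-- An edge-weighted tree whose vertex set contains `X` (through the injection `point`); it may
have further vertices. -/
structure WeightedTree (X : Type*) where
  /-- the vertices -/
  Vertex : Type
  /-- the underlying graph -/
  graph : SimpleGraph Vertex
  isTree : graph.IsTree
  /-- the edge weights -/
  weight : Sym2 Vertex → ℝ
  weight_nonneg : ∀ e ∈ graph.edgeSet, 0 ≤ weight e
  /-- the points of `X` as vertices of the tree -/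
  point : X ↪ Vertex

namespace WeightedTree

/-- The tree distance of two points of `X`: the length of the unique path joining them. -/
noncomputable def treeDist {X : Type*} (T : WeightedTree X) (x y : X) : ℝ :=
  walkLength T.weight (T.isTree.existsUnique_path (T.point x) (T.point y)).choose

/-- The tree does not shrink any distance of `X`. -/
def IsDominating {X : Type*} [MetricSpace X] (T : WeightedTree X) : Prop :=
  ∀ x y : X, dist x y ≤ T.treeDist x y

end WeightedTree

/-- The `k` trees `T` form a Ramsey `(α, k)`-tree cover of `X`: all of them are dominating, and
every point `u` has a tree with distortion at most `α` for all pairs `u, v`. -/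
def IsRamseyTreeCover {X : Type*} [MetricSpace X] (α : ℝ) {k : ℕ}
    (T : Fin k → WeightedTree X) : Prop :=
  (∀ i, (T i).IsDominating) ∧
  ∀ u : X, ∃ i, ∀ v : X, (T i).treeDist u v ≤ α * dist u v

/-! ### Planarity of graphs whose edges are noncrossing chords -/

/-! The hard spaces are towers of cycles. With m about 9α, level l + 1 is a cycle of m vertices with
edge length m^l and a copy of level l hung at each vertex; this edge length also bounds the radius
of a copy. In a dominating tree, call a point good if its distances to all points are stretched at
most by α. If every copy contained a good point, one good point per copy would map the m-cycle into
the tree with distortion 3α, because chosen points of neighbouring copies are within 3m^l.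
`no_low_distortion_cycle` excludes this: at a tree vertex minimizing the sum of hop distances to the
images, more than half of the images would lie in one branch. So the good points miss a copy at
every level, at most (m - 1)^l of the m^l points are good, and k ≥ (m / (m - 1))^l ≥ e^(l/m), where
l is about ln n / ln α.

To reach exactly n points, the largest tower with at most n points is hung on one more cycle, whose
other vertices stay bare. Each gluing preserves the doubling constant 64 (`glue_isDoublingWith`) and
a noncrossing numbering of the graph (`glue_isOuterplanar`), which gives planarity by drawing edges
as chords of a parabola. -/

lemma mem_segment_parabola {a b : ℝ} {z : ℝ × ℝ}
    (hz : z ∈ segment ℝ ((a, a ^ 2) : ℝ × ℝ) (b, b ^ 2)) :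
    (z.1 - a) * (z.1 - b) ≤ 0 ∧ z.2 = (a + b) * z.1 - a * b := by
  obtain ⟨s, t, hs, ht, hst, rfl⟩ := hz
  obtain rfl : s = 1 - t := by linarith
  simp only [Prod.smul_mk, Prod.mk_add_mk, smul_eq_mul]
  constructor
  · have h : ((1 - t) * a + t * b - a) * ((1 - t) * a + t * b - b)
        = -((1 - t) * t * (a - b) ^ 2) := by ring
    rw [h]
    have := mul_nonneg (mul_nonneg hs ht) (sq_nonneg (a - b))
    linarith
  · ring

/-- The chord of y = x² over [a, b] satisfies x² - y = (x - a)(x - b), so `h` says that the two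
chords have the same height at x. Chords that do not interleave are nested or side by side, and then
equal heights occur only at a shared end. -/
lemma chord_inter_of_le {a b c d : ℕ} (hab : a < b) (hcd : c < d) (hac : a ≤ c)
    (hne : ¬(a = c ∧ b = d)) (hnc : ¬(a < c ∧ c < b ∧ b < d)) {x : ℝ}
    (h₁ : (x - a) * (x - b) ≤ 0) (h₂ : (x - c) * (x - d) ≤ 0)
    (h : (x - a) * (x - b) = (x - c) * (x - d)) :
    ∃ t : ℕ, (t = a ∨ t = b) ∧ (t = c ∨ t = d) ∧ (t : ℝ) = x := by
  have hab' : (a : ℝ) < b := by exact_mod_cast hab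
  have hcd' : (c : ℝ) < d := by exact_mod_cast hcd
  have xa : (a : ℝ) ≤ x := by nlinarith
  have xb : x ≤ b := by nlinarith
  have xc : (c : ℝ) ≤ x := by nlinarith
  have xd : x ≤ d := by nlinarith
  rcases lt_or_ge c b with hcb | hcb
  · rcases hac.lt_or_eq with hac | rfl
    · have hdb : d ≤ b := by by_contra hd; exact hnc ⟨hac, hcb, by omega⟩
      have hac' : (a : ℝ) < c := by exact_mod_cast hac
      have hdb' : (d : ℝ) ≤ b := by exact_mod_cast hdb
      have hx : x = d := by nlinarith
      have hbd : (b : ℝ) = d := by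
        subst hx
        have : ((d : ℝ) - a) * (d - b) = 0 := by rw [h]; ring
        rcases mul_eq_zero.1 this with h | h <;> linarith
      exact ⟨d, Or.inr (by exact_mod_cast hbd.symm), Or.inr rfl, hx.symm⟩
    · have hbd : (b : ℝ) ≠ d := fun hbd => hne ⟨rfl, by exact_mod_cast hbd⟩
      have : (x - a) * ((d : ℝ) - b) = 0 := by linarith
      rcases mul_eq_zero.1 this with h | h
      · exact ⟨a, Or.inl rfl, Or.inl rfl, by linarith⟩
      · exact absurd (by linarith) hbd
  · have hcb' : (b : ℝ) ≤ c := by exact_mod_cast hcb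
    have : (c : ℝ) = b := by linarith
    exact ⟨c, Or.inr (by exact_mod_cast this), Or.inl rfl, by linarith⟩

lemma chord_inter {a b c d : ℕ} (hab : a < b) (hcd : c < d)
    (hne : ¬(a = c ∧ b = d)) (hnc : ¬(a < c ∧ c < b ∧ b < d)) (hnc' : ¬(c < a ∧ a < d ∧ d < b))
    {x : ℝ} (h₁ : (x - a) * (x - b) ≤ 0) (h₂ : (x - c) * (x - d) ≤ 0)
    (h : (x - a) * (x - b) = (x - c) * (x - d)) :
    ∃ t : ℕ, (t = a ∨ t = b) ∧ (t = c ∨ t = d) ∧ (t : ℝ) = x := by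
  rcases le_total a c with hac | hac
  · exact chord_inter_of_le hab hcd hac hne hnc h₁ h₂ h
  · obtain ⟨t, h₁, h₂, h₃⟩ := chord_inter_of_le hcd hab hac
      (fun h => hne ⟨h.1.symm, h.2.symm⟩) hnc' h₂ h₁ h.symm
    exact ⟨t, h₂, h₁, h₃⟩

lemma exists_injective_path_segment {p q : ℝ × ℝ} (hpq : p ≠ q) :
    ∃ γ : Path p q, Function.Injective γ ∧ Set.range γ = segment ℝ p q := by
  refine ⟨⟨⟨fun t => AffineMap.lineMap p q (t : ℝ), by fun_prop⟩, by simp, by simp⟩, ?_, ?_⟩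
  · intro s t hst
    exact Subtype.ext (AffineMap.lineMap_injective ℝ hpq hst)
  · rw [segment_eq_image_lineMap]
    ext z
    constructor
    · rintro ⟨t, rfl⟩
      exact ⟨t, t.2, rfl⟩
    · rintro ⟨t, ht, rfl⟩
      exact ⟨⟨t, ht⟩, rfl⟩

/-- A graph is noncrossing with respect to a numbering of its vertices if no two of its edges
interleave. -/
def SimpleGraph.IsNoncrossing {V : Type*} (G : SimpleGraph V) (h : V → ℕ) : Prop :=
  ∀ a b c d, G.Adj a c → G.Adj b d → h a < h b → h b < h c → h c < h d → False

/-- Place the vertices on a parabola and draw the edges as chords. -/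
theorem SimpleGraph.IsNoncrossing.isPlanarGraph {V : Type*} {G : SimpleGraph V} {h : V → ℕ}
    (hG : G.IsNoncrossing h) (hinj : Function.Injective h) : IsPlanarGraph G := by
  have hor : ∀ e ∈ G.edgeSet, ∃ u v, e = s(u, v) ∧ G.Adj u v ∧ h u < h v := by
    intro e he
    induction e using Sym2.ind with
    | _ u v =>
      have huv : G.Adj u v := he
      rcases lt_trichotomy (h u) (h v) with hlt | heq | hlt
      · exact ⟨u, v, rfl, huv, hlt⟩
      · exact absurd (hinj heq) huv.ne
      · exact ⟨v, u, Sym2.eq_swap, huv.symm, hlt⟩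
  let pos : V → ℝ × ℝ := fun v => ((h v : ℝ), (h v : ℝ) ^ 2)
  have hpos : Function.Injective pos := by
    intro u v huv
    have : (h u : ℝ) = h v := congrArg Prod.fst huv
    exact hinj (by exact_mod_cast this)
  refine ⟨pos, fun e => Sym2.lift ⟨fun u v => segment ℝ (pos u) (pos v),
    fun u v => segment_symm ℝ _ _⟩ e, hpos, ?_, ?_, ?_⟩
  · intro u v huv
    exact exists_injective_path_segment (fun h => huv.ne (hpos h))
  · intro e he c hc
    obtain ⟨u, v, rfl, -, -⟩ := hor e he
    obtain ⟨-, hc⟩ := mem_segment_parabola hc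
    have : ((h c : ℝ) - h u) * (h c - h v) = 0 := by
      change (h c : ℝ) ^ 2 = (h u + h v) * h c - h u * h v at hc
      linarith
    rcases mul_eq_zero.1 this with hcu | hcu
    · have : (h c : ℝ) = h u := by linarith
      rw [hinj (by exact_mod_cast this : h c = h u)]
      exact Sym2.mem_mk_left _ _
    · have : (h c : ℝ) = h v := by linarith
      rw [hinj (by exact_mod_cast this : h c = h v)]
      exact Sym2.mem_mk_right _ _
  · rintro e he f hf hef z ⟨hze, hzf⟩
    obtain ⟨a, b, rfl, hab, hab'⟩ := hor e he
    obtain ⟨c, d, rfl, hcd, hcd'⟩ := hor f hf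
    obtain ⟨h₁, h₁'⟩ := mem_segment_parabola hze
    obtain ⟨h₂, h₂'⟩ := mem_segment_parabola hzf
    obtain ⟨t, ht₁, ht₂, ht₃⟩ := chord_inter hab' hcd'
      (fun hh => hef (by rw [hinj hh.1, hinj hh.2]))
      (fun hh => hG a c b d hab hcd hh.1 hh.2.1 hh.2.2)
      (fun hh => hG c a d b hcd hab hh.1 hh.2.1 hh.2.2) h₁ h₂ (by linarith)
    have key : ∃ v : V, h v = t ∧ v ∈ s(a, b) ∧ v ∈ s(c, d) := by
      rcases ht₁ with rfl | rfl
      · refine ⟨a, rfl, Sym2.mem_mk_left _ _, ?_⟩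
        rcases ht₂ with hh | hh <;> rw [hinj hh] <;> simp
      · refine ⟨b, rfl, Sym2.mem_mk_right _ _, ?_⟩
        rcases ht₂ with hh | hh <;> rw [hinj hh] <;> simp
    obtain ⟨v, rfl, hv, hv'⟩ := key
    refine ⟨v, hv, hv', ?_⟩
    ext
    · exact ht₃
    · change (h v : ℝ) ^ 2 = z.2
      rcases Sym2.mem_iff.1 hv with rfl | rfl <;> rw [h₁', ← ht₃] <;> ring

/-! ### The metric of the cycle -/

/-- The distance of two vertices of the cycle `ZMod q`. -/
def cycleDist {q : ℕ} (a b : ZMod q) : ℕ := (a - b).valMinAbs.natAbs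

section CycleDist

variable {q : ℕ}

@[simp] lemma cycleDist_self (a : ZMod q) : cycleDist a a = 0 := by simp [cycleDist]

lemma cycleDist_comm (a b : ZMod q) : cycleDist a b = cycleDist b a := by
  rw [cycleDist, cycleDist, ← neg_sub, ZMod.natAbs_valMinAbs_neg]

lemma cycleDist_triangle (a b c : ZMod q) : cycleDist a c ≤ cycleDist a b + cycleDist b c := by
  have h := ZMod.natAbs_valMinAbs_add_le (a - b) (b - c)
  rw [sub_add_sub_cancel] at h
  exact h.trans (Int.natAbs_add_le _ _)

lemma eq_of_cycleDist_eq_zero {a b : ZMod q} (h : cycleDist a b = 0) : a = b := by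
  rw [cycleDist, Int.natAbs_eq_zero, ZMod.valMinAbs_eq_zero] at h
  exact sub_eq_zero.1 h

lemma one_le_cycleDist {a b : ZMod q} (h : a ≠ b) : 1 ≤ cycleDist a b :=
  Nat.one_le_iff_ne_zero.2 fun h' => h (eq_of_cycleDist_eq_zero h')

lemma cycleDist_add_natCast {j : ℕ} (a : ZMod q) (hj : 2 * j ≤ q) : cycleDist (a + (j : ZMod q)) a = j := by
  rw [cycleDist, add_sub_cancel_left, ZMod.valMinAbs_natCast_of_le_half (by omega)]
  rfl

variable [NeZero q]

lemma two_mul_cycleDist_le (a b : ZMod q) : 2 * cycleDist a b ≤ q := by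
  have := ZMod.natAbs_valMinAbs_le (a - b)
  rw [cycleDist]
  omega

lemma cycleDist_add_intCast_le (a : ZMod q) (i : ℤ) : cycleDist (a + (i : ZMod q)) a ≤ i.natAbs := by
  rw [cycleDist, add_sub_cancel_left]
  exact ZMod.natAbs_min_of_le_div_two q _ _ (ZMod.coe_valMinAbs _) (ZMod.natAbs_valMinAbs_le _)

lemma cycleDist_add_one_le (a : ZMod q) : cycleDist (a + 1) a ≤ 1 := by
  simpa using cycleDist_add_intCast_le a 1

lemma le_three_mul_cycleDist {j : ℕ} (a : ZMod q) (hj : q ≤ 3 * j) (hj' : 3 * j ≤ 2 * q) :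
    q ≤ 3 * cycleDist (a + (j : ZMod q)) a := by
  have hq : 0 < q := NeZero.pos q
  rw [cycleDist, add_sub_cancel_left, ZMod.valMinAbs_natAbs_eq_min,
    ZMod.val_natCast_of_lt (by omega)]
  omega

/-- A set of pairwise close vertices of a cycle leaves a long arc free. -/
lemma exists_free_arc {P : Set (ZMod q)} (hP : ∀ i ∈ P, ∀ j ∈ P, 3 * cycleDist i j < q) :
    ∃ a : ZMod q, ∀ j : ℕ, 1 ≤ j → 3 * j ≤ 2 * q → a + (j : ZMod q) ∉ P := by
  classical
  by_contra! hcon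
  obtain ⟨j₀, -, -, hj₀⟩ := hcon 0
  set b : ZMod q := 0 + j₀
  have hex : ∃ j : ℕ, 3 * j < q ∧ b + (j : ZMod q) ∈ P := ⟨0, by simpa using NeZero.pos q, by simpa using hj₀⟩
  -- The last point of P within the first third after b. The next point of P comes k steps later;
  -- neither k nor J + k may lie in [q/3, 2q/3], where distances are at least q/3, so J + k < q/3,
  -- against maximality.
  let J := Nat.findGreatest (fun j => 3 * j < q ∧ b + (j : ZMod q) ∈ P) q
  obtain ⟨j, hj⟩ := hex
  have hJ : 3 * J < q ∧ b + (J : ZMod q) ∈ P :=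
    Nat.findGreatest_spec (P := fun j => 3 * j < q ∧ b + (j : ZMod q) ∈ P) (m := j) (by omega) hj
  obtain ⟨k, hk, hk', hkP⟩ := hcon (b + J)
  have hk3 : 3 * k < q := by
    by_contra hkq
    have := le_three_mul_cycleDist (b + J : ZMod q) (not_lt.1 hkq) hk'
    have := hP _ hkP _ hJ.2
    omega
  rw [add_assoc, ← Nat.cast_add] at hkP
  have hq : 3 * (J + k) < q := by
    by_contra hkq
    have := le_three_mul_cycleDist b (not_lt.1 hkq) (by omega)
    have := hP _ hkP _ hj₀
    omega
  have : J + k ≤ J :=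
    Nat.le_findGreatest (P := fun j => 3 * j < q ∧ b + (j : ZMod q) ∈ P) (by omega) ⟨hq, hkP⟩
  omega

end CycleDist

/-! ### Distances in weighted trees -/

section Walk

variable {V : Type*} {G : SimpleGraph V} {w : Sym2 V → ℝ}

lemma walkLength_append {u v x : V} (p : G.Walk u v) (p' : G.Walk v x) :
    walkLength w (p.append p') = walkLength w p + walkLength w p' := by
  simp [walkLength, SimpleGraph.Walk.edges_append]

lemma walkLength_reverse {u v : V} (p : G.Walk u v) :
    walkLength w p.reverse = walkLength w p := by
  simp [walkLength, SimpleGraph.Walk.edges_reverse, List.sum_reverse]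

lemma walkLength_bypass_le [DecidableEq V] (hw : ∀ e ∈ G.edgeSet, 0 ≤ w e) {u v : V}
    (p : G.Walk u v) : walkLength w p.bypass ≤ walkLength w p := by
  refine List.Sublist.sum_le_sum (p.edges_bypass_sublist_edges.map w) fun x hx => ?_
  obtain ⟨e, he, rfl⟩ := List.mem_map.1 hx
  exact hw e (p.edges_subset_edgeSet he)

/-- The weighted distance of two vertices of a tree. -/
noncomputable def pathDist (hG : G.IsTree) (w : Sym2 V → ℝ) (u v : V) : ℝ :=
  walkLength w (hG.existsUnique_path u v).choose

lemma pathDist_eq (hG : G.IsTree) {u v : V} {p : G.Walk u v} (hp : p.IsPath) :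
    pathDist hG w u v = walkLength w p := by
  rw [pathDist, (hG.existsUnique_path u v).unique (hG.existsUnique_path u v).choose_spec.1 hp]

lemma pathDist_comm (hG : G.IsTree) (u v : V) : pathDist hG w u v = pathDist hG w v u := by
  obtain ⟨p, hp, -⟩ := hG.existsUnique_path u v
  rw [pathDist_eq hG hp, pathDist_eq hG hp.reverse, walkLength_reverse]

lemma pathDist_triangle (hG : G.IsTree) (hw : ∀ e ∈ G.edgeSet, 0 ≤ w e) (u v x : V) :
    pathDist hG w u x ≤ pathDist hG w u v + pathDist hG w v x := by
  classical
  obtain ⟨p, hp, -⟩ := hG.existsUnique_path u v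
  obtain ⟨p', hp', -⟩ := hG.existsUnique_path v x
  rw [pathDist_eq hG hp, pathDist_eq hG hp', ← walkLength_append,
    pathDist_eq hG (p.append p').bypass_isPath]
  exact walkLength_bypass_le hw _

lemma pathDist_add_of_mem_support (hG : G.IsTree) {u v x : V} {p : G.Walk u x} (hp : p.IsPath)
    (hv : v ∈ p.support) : pathDist hG w u v + pathDist hG w v x = pathDist hG w u x := by
  classical
  rw [pathDist_eq hG (hp.takeUntil hv), pathDist_eq hG (hp.dropUntil hv), ← walkLength_append,
    SimpleGraph.Walk.take_spec, pathDist_eq hG hp]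

/-- The branch at `v` through `u` contains `x`: some walk from `u` to `x` avoids `v`. -/
def SimpleGraph.InBranch (G : SimpleGraph V) (v u x : V) : Prop :=
  ∃ p : G.Walk u x, v ∉ p.support

lemma SimpleGraph.InBranch.append {v u x y : V} (h : G.InBranch v u x) {p : G.Walk x y}
    (hp : v ∉ p.support) : G.InBranch v u y := by
  obtain ⟨p', hp'⟩ := h
  refine ⟨p'.append p, fun hv => ?_⟩
  rcases (SimpleGraph.Walk.mem_support_append_iff _ _).1 hv with hv | hv
  exacts [hp' hv, hp hv]

lemma SimpleGraph.IsTree.exists_inBranch (hG : G.IsTree) {v x : V} (h : x ≠ v) :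
    ∃ u, G.Adj v u ∧ G.InBranch v u x := by
  obtain ⟨p, hp, -⟩ := hG.existsUnique_path v x
  cases p with
  | nil => exact absurd rfl h
  | cons hvu p => exact ⟨_, hvu, p, ((SimpleGraph.Walk.cons_isPath_iff _ _).1 hp).2⟩

/-- A path from u to x that avoids v stays a path when v is prepended, and paths in a tree are
unique, hence shortest. -/
lemma SimpleGraph.IsTree.dist_eq_of_inBranch (hG : G.IsTree) {v u x : V} (huv : G.Adj v u)
    (h : G.InBranch v u x) : G.dist v x = G.dist u x + 1 := by
  classical
  obtain ⟨p, hp⟩ := h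
  have hq : (SimpleGraph.Walk.cons huv p.bypass).IsPath :=
    p.bypass_isPath.cons fun hv => hp (p.support_bypass_subset_support hv)
  have hlen : ∀ {a b : V} {r : G.Walk a b}, r.IsPath → G.dist a b = r.length := by
    intro a b r hr
    obtain ⟨r', hr', hr''⟩ := hG.connected.exists_path_of_dist a b
    rw [← hr'', (hG.existsUnique_path a b).unique hr hr']
  rw [hlen hq, hlen p.bypass_isPath, SimpleGraph.Walk.length_cons]

/-- A long cycle cannot be mapped to a weighted tree with small distortion. -/
theorem no_low_distortion_cycle (hG : G.IsTree) (hw : ∀ e ∈ G.edgeSet, 0 ≤ w e) {q : ℕ} [NeZero q]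
    (x : ZMod q → V) {β W : ℝ} (hW : 0 < W) (hβ : 3 * (β + 1) < q)
    (hup : ∀ i, pathDist hG w (x i) (x (i + 1)) ≤ β * W)
    (hlow : ∀ i j, W * cycleDist i j ≤ pathDist hG w (x i) (x j)) : False := by
  classical
  -- A median of the images for the hop distance; the weights play no role in its choice.
  obtain ⟨v, hv⟩ : ∃ v, ∀ u, ∑ i, G.dist v (x i) ≤ ∑ i, G.dist u (x i) := by
    have : Nonempty V := ⟨x 0⟩
    exact ⟨Function.argmin fun u => ∑ i, G.dist u (x i),
      fun u => Function.argmin_le (fun u => ∑ i, G.dist u (x i)) u⟩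
  choose p hp _ using fun i : ZMod q => hG.existsUnique_path (x i) (x (i + 1))
  -- If v lies on the path from x i to x (i + 1), the nearer end is within half of the path length.
  have hnear : ∀ i, v ∈ (p i).support →
      ∃ e : ℕ, e ≤ 1 ∧ 2 * pathDist hG w (x (i + e)) v ≤ β * W := by
    intro i hi
    have h := pathDist_add_of_mem_support (w := w) hG (hp i) hi
    have h' := hup i
    rw [pathDist_comm hG v] at h
    rcases le_total (pathDist hG w (x i) v) (pathDist hG w (x (i + 1)) v) with hle | hle
    · exact ⟨0, by omega, by simp only [Nat.cast_zero, add_zero]; linarith⟩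
    · exact ⟨1, by omega, by simp only [Nat.cast_one]; linarith⟩
  obtain ⟨a, ha⟩ := exists_free_arc (P := {i | v ∈ (p i).support}) (by
    intro i hi j hj
    obtain ⟨e, he, hie⟩ := hnear i hi
    obtain ⟨f, hf, hjf⟩ := hnear j hj
    have h₁ := pathDist_triangle hG hw (x (i + e)) v (x (j + f))
    rw [pathDist_comm hG v] at h₁
    have h₂ : W * cycleDist (i + (e : ZMod q)) (j + f) ≤ W * β :=
      (hlow _ _).trans (by linarith)
    have h₃ := le_of_mul_le_mul_left h₂ hW
    -- The shift e - f is -1, 0 or 1.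
    have h₄ : cycleDist i j ≤ cycleDist (i + (e : ZMod q)) (j + f) + 1 := by
      have h := cycleDist_add_intCast_le (i - j) (e - f : ℤ)
      have h' := cycleDist_triangle (i - j) (i - j + ((e - f : ℤ) : ZMod q)) 0
      rw [cycleDist_comm] at h
      have e₁ : cycleDist (i - j) 0 = cycleDist i j := by simp [cycleDist]
      have e₂ : cycleDist (i - j + ((e - f : ℤ) : ZMod q)) 0
          = cycleDist (i + (e : ZMod q)) (j + f) := by
        rw [cycleDist, cycleDist]; push_cast; congr 2; ring
      omega
    have h₅ : (cycleDist i j : ℝ) ≤ cycleDist (i + (e : ZMod q)) (j + f) + 1 := by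
      exact_mod_cast h₄
    have : (3 * cycleDist i j : ℝ) < q := by linarith
    exact_mod_cast this)
  have hq : 0 < q := NeZero.pos q
  have hx : x (a + 1) ≠ v := by
    intro hxv
    rcases Nat.lt_or_ge 1 q with h1 | h1
    · apply ha 1 le_rfl (by omega)
      have := (p (a + (1 : ℕ))).start_mem_support
      rw [Set.mem_ofPred_eq]
      convert this
      simp [hxv]
    -- For q = 1 the bound on β makes it negative, whereas 0 ≤ β * W.
    · have : (q : ℝ) ≤ 1 := by exact_mod_cast h1
      have h := hup 0
      have h' := hlow 0 (0 + 1)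
      have h'' : 0 ≤ W * cycleDist (0 : ZMod q) (0 + 1) := by positivity
      have : 0 ≤ β * W := by linarith
      have := nonneg_of_mul_nonneg_left this hW
      linarith
  obtain ⟨u, hvu, hu⟩ := hG.exists_inBranch hx
  have hbranch : ∀ j : ℕ, 3 * j ≤ 2 * q → G.InBranch v u (x (a + (j + 1 : ℕ))) := by
    intro j
    induction j with
    | zero => intro _; simpa using hu
    | succ j ih =>
      intro hj
      have h := (ih (by omega)).append (ha (j + 1) (by omega) hj)
      convert h using 2
      push_cast; ring
  set B := Finset.univ.filter fun i => G.InBranch v u (x i) with hB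
  have hBcard : 2 * q / 3 + 1 ≤ B.card := by
    rw [← Finset.card_range (2 * q / 3 + 1)]
    refine Finset.card_le_card_of_injOn (fun j => a + ((j + 1 : ℕ) : ZMod q)) ?_ ?_
    · intro j hj
      have hj := Finset.mem_range.1 hj
      simp only [hB, Finset.coe_filter, Finset.mem_univ, true_and, Set.mem_ofPred_eq]
      exact hbranch j (by omega)
    · intro i hi j hj hij
      have hi := Finset.mem_range.1 hi
      have hj := Finset.mem_range.1 hj
      have h : ((i : ℕ) : ZMod q) = j := by
        have := add_left_cancel hij
        push_cast at this
        exact add_right_cancel this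
      rw [ZMod.natCast_eq_natCast_iff', Nat.mod_eq_of_lt (by omega),
        Nat.mod_eq_of_lt (by omega)] at h
      exact h
  -- Moving from v to u shortens the distance by one on B and lengthens it by at most one elsewhere.
  -- As B has more than 2q/3 of the q indices, the sum drops, against the choice of v.
  have hsum : ∑ i, (G.dist u (x i) + if G.InBranch v u (x i) then 2 else 0)
      ≤ ∑ i, (G.dist v (x i) + 1) := by
    refine Finset.sum_le_sum fun i _ => ?_
    split_ifs with hi
    · rw [hG.dist_eq_of_inBranch hvu hi]
    · have h := hG.connected.dist_triangle (u := u) (v := v) (w := x i)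
      have : G.dist u v = 1 := SimpleGraph.dist_eq_one_iff_adj.2 hvu.symm
      omega
  rw [Finset.sum_add_distrib, Finset.sum_add_distrib, ← Finset.sum_filter, Finset.sum_const,
    Finset.sum_const, Finset.card_univ, ZMod.card, ← hB] at hsum
  have := hv u
  simp only [smul_eq_mul] at hsum
  omega

end Walk

/-! ### Gluing pointed metric spaces to the vertices of a cycle -/

/-- A finite metric space with a distinguished point. -/
structure PointedSpace where
  /-- the points -/
  carrier : Type
  /-- the metric -/
  metric : MetricSpace carrier
  /-- there are finitely many points -/
  fintype : Fintype carrier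
  /-- the distinguished point -/
  root : carrier

attribute [instance] PointedSpace.metric PointedSpace.fintype

section Glue

variable {q : ℕ} (W : ℝ) (Y : ZMod q → PointedSpace)

open Classical in
/-- The distance in the space obtained from a cycle with edges of length `W` by gluing the root of
`Y b` to the vertex `b`. -/
noncomputable def glueDist (x y : Σ b, (Y b).carrier) : ℝ :=
  if h : x.1 = y.1 then dist (h ▸ x.2) y.2
  else dist x.2 (Y x.1).root + W * cycleDist x.1 y.1 + dist (Y y.1).root y.2

variable {W Y}

@[simp] lemma glueDist_same (b : ZMod q) (x y : (Y b).carrier) :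
    glueDist W Y ⟨b, x⟩ ⟨b, y⟩ = dist x y := by
  simp [glueDist]

lemma glueDist_of_ne {a b : ZMod q} (h : a ≠ b) (x : (Y a).carrier) (y : (Y b).carrier) :
    glueDist W Y ⟨a, x⟩ ⟨b, y⟩
      = dist x (Y a).root + W * cycleDist a b + dist (Y b).root y := by
  simp [glueDist, h]

lemma glueDist_le (a b : ZMod q) (x : (Y a).carrier) (y : (Y b).carrier) :
    glueDist W Y ⟨a, x⟩ ⟨b, y⟩
      ≤ dist x (Y a).root + W * cycleDist a b + dist (Y b).root y := by
  by_cases h : a = b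
  · subst h
    simpa using dist_triangle x (Y a).root y
  · exact (glueDist_of_ne h x y).le

lemma le_glueDist (a b : ZMod q) (x : (Y a).carrier) (y : (Y b).carrier) :
    W * cycleDist a b ≤ glueDist W Y ⟨a, x⟩ ⟨b, y⟩ := by
  by_cases h : a = b
  · subst h
    simp
  · rw [glueDist_of_ne h]
    have := dist_nonneg (x := x) (y := (Y a).root)
    have := dist_nonneg (x := (Y b).root) (y := y)
    linarith

lemma glueDist_comm (x y : Σ b, (Y b).carrier) : glueDist W Y x y = glueDist W Y y x := by
  obtain ⟨a, x⟩ := x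
  obtain ⟨b, y⟩ := y
  by_cases h : a = b
  · subst h
    simp [dist_comm]
  · rw [glueDist_of_ne h, glueDist_of_ne (Ne.symm h), cycleDist_comm, dist_comm x,
      dist_comm _ y]
    ring

lemma glueDist_triangle (hW : 0 < W) (x y z : Σ b, (Y b).carrier) :
    glueDist W Y x z ≤ glueDist W Y x y + glueDist W Y y z := by
  obtain ⟨a, x⟩ := x
  obtain ⟨b, y⟩ := y
  obtain ⟨c, z⟩ := z
  by_cases hab : a = b
  · subst hab
    by_cases hac : a = c
    · subst hac
      simpa using dist_triangle x y z
    · rw [glueDist_of_ne hac, glueDist_of_ne hac, glueDist_same]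
      linarith [dist_triangle x y (Y a).root]
  · by_cases hbc : b = c
    · subst hbc
      rw [glueDist_of_ne hab, glueDist_of_ne hab, glueDist_same]
      linarith [dist_triangle (Y b).root y z]
    · refine (glueDist_le a c x z).trans ?_
      rw [glueDist_of_ne hab, glueDist_of_ne hbc]
      have h : (cycleDist a c : ℝ) ≤ cycleDist a b + cycleDist b c := by
        exact_mod_cast cycleDist_triangle a b c
      have := mul_le_mul_of_nonneg_left h hW.le
      have := dist_nonneg (x := (Y b).root) (y := y)
      have := dist_nonneg (x := y) (y := (Y b).root)
      linarith

lemma eq_of_glueDist_eq_zero (hW : 0 < W) {x y : Σ b, (Y b).carrier}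
    (h : glueDist W Y x y = 0) : x = y := by
  obtain ⟨a, x⟩ := x
  obtain ⟨b, y⟩ := y
  by_cases hab : a = b
  · subst hab
    rw [glueDist_same, dist_eq_zero] at h
    rw [h]
  · have h₁ : (1 : ℝ) ≤ cycleDist a b := by exact_mod_cast one_le_cycleDist hab
    have h₂ := le_glueDist (W := W) a b x y
    have := mul_pos hW (zero_lt_one.trans_le h₁)
    linarith

variable [NeZero q] (Y)

/-- The space obtained from a cycle with edges of length `W` by gluing the root of `Y b` to the
vertex `b`. -/
noncomputable def glue (hW : 0 < W) : PointedSpace where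
  carrier := Σ b, (Y b).carrier
  metric :=
    { dist := glueDist W Y
      dist_self := fun x => by
        obtain ⟨a, x⟩ := x
        simp
      dist_comm := glueDist_comm
      dist_triangle := glueDist_triangle hW
      eq_of_dist_eq_zero := eq_of_glueDist_eq_zero hW }
  fintype := inferInstance
  root := ⟨0, (Y 0).root⟩

variable (hW : 0 < W)

/-- The point `y` of the piece glued to the vertex `b`. -/
def glueMk (b : ZMod q) (y : (Y b).carrier) : (glue Y hW).carrier := ⟨b, y⟩

lemma glue_cases (x : (glue Y hW).carrier) : ∃ b y, x = glueMk Y hW b y := ⟨x.1, x.2, rfl⟩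

lemma glueMk_injective (b : ZMod q) : Function.Injective (glueMk Y hW b) :=
  fun _ _ h => sigma_mk_injective (i := b) h

variable {Y}

@[simp] lemma dist_glueMk_same (b : ZMod q) (x y : (Y b).carrier) :
    dist (glueMk Y hW b x) (glueMk Y hW b y) = dist x y :=
  glueDist_same b x y

lemma dist_glueMk_of_ne {a b : ZMod q} (h : a ≠ b) (x : (Y a).carrier) (y : (Y b).carrier) :
    dist (glueMk Y hW a x) (glueMk Y hW b y)
      = dist x (Y a).root + W * cycleDist a b + dist (Y b).root y :=
  glueDist_of_ne h x y

lemma dist_glueMk_le (a b : ZMod q) (x : (Y a).carrier) (y : (Y b).carrier) :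
    dist (glueMk Y hW a x) (glueMk Y hW b y)
      ≤ dist x (Y a).root + W * cycleDist a b + dist (Y b).root y :=
  glueDist_le a b x y

lemma le_dist_glueMk (a b : ZMod q) (x : (Y a).carrier) (y : (Y b).carrier) :
    W * cycleDist a b ≤ dist (glueMk Y hW a x) (glueMk Y hW b y) :=
  le_glueDist a b x y

lemma dist_glueMk_root (a b : ZMod q) :
    dist (glueMk Y hW a (Y a).root) (glueMk Y hW b (Y b).root) = W * cycleDist a b :=
  le_antisymm (by simpa using dist_glueMk_le hW a b (Y a).root (Y b).root) (le_dist_glueMk ..)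

lemma card_glue : Fintype.card (glue Y hW).carrier = ∑ b, Fintype.card (Y b).carrier :=
  Fintype.card_sigma

lemma glue_radius_le (hY : ∀ b y, dist y (Y b).root ≤ W) (hq : 2 ≤ q) (x : (glue Y hW).carrier) :
    dist x (glue Y hW).root ≤ W * q := by
  obtain ⟨b, y, rfl⟩ := glue_cases Y hW x
  have h := dist_glueMk_le hW b 0 y (Y 0).root
  rw [dist_self, add_zero] at h
  refine h.trans ?_
  have h₁ : (2 * cycleDist b 0 : ℝ) ≤ q := by exact_mod_cast two_mul_cycleDist_le b 0
  have h₂ : (2 : ℝ) ≤ q := by exact_mod_cast hq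
  have h₃ := hY b y
  nlinarith

/-! ### The doubling constant of a glued space -/

omit W Y in
-- The centres are b + ta for -4 ≤ a ≤ 3, with t the least integer above ρ/2. Offsets from b are
-- below 4t in absolute value, and division by t leaves a remainder of at most t - 1 ≤ ρ/2.
lemma exists_cycle_net (b : ZMod q) {ρ : ℝ} (hρ : 0 ≤ ρ) :
    ∃ s : Finset (ZMod q), s.card ≤ 8 ∧
      ∀ b', (cycleDist b' b : ℝ) ≤ 2 * ρ → ∃ c ∈ s, 2 * (cycleDist b' c : ℝ) ≤ ρ := by
  classical
  set t : ℤ := ⌊ρ / 2⌋₊ + 1 with ht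
  have ht0 : 0 < t := by positivity
  have htρ : ρ < 2 * t := by
    have := Nat.lt_floor_add_one (ρ / 2)
    rw [ht]; push_cast; linarith
  have htρ' : (2 * (t - 1) : ℝ) ≤ ρ := by
    have := Nat.floor_le (show 0 ≤ ρ / 2 by positivity)
    rw [ht]; push_cast; linarith
  refine ⟨(Finset.Icc (-4 : ℤ) 3).image fun a => b + ((t * a : ℤ) : ZMod q),
    Finset.card_image_le.trans (by simp), fun b' hb' => ?_⟩
  set i := (b' - b).valMinAbs with hi
  have hi4 : (i.natAbs : ℤ) < 4 * t := by
    have : (i.natAbs : ℝ) < 4 * t := by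
      change (i.natAbs : ℝ) ≤ 2 * ρ at hb'
      linarith
    rw [Nat.cast_natAbs] at this
    rw [Int.natCast_natAbs]
    exact_mod_cast this
  have hdiv := Int.mul_ediv_add_emod i t
  have hmod := Int.emod_nonneg i ht0.ne'
  have hmod' := Int.emod_lt_of_pos i ht0
  refine ⟨_, Finset.mem_image_of_mem _ (a := i / t) (Finset.mem_Icc.2 ⟨?_, ?_⟩), ?_⟩
  · rw [Int.le_ediv_iff_mul_le ht0]
    omega
  · refine Int.lt_add_one_iff.1 ((Int.ediv_lt_iff_lt_mul ht0).2 ?_)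
    omega
  · have hb : b' = b + ((t * (i / t) : ℤ) : ZMod q) + ((i % t : ℤ) : ZMod q) := by
      rw [add_assoc, ← Int.cast_add, hdiv, hi, ZMod.coe_valMinAbs]
      ring
    have h := cycleDist_add_intCast_le (b + ((t * (i / t) : ℤ) : ZMod q)) (i % t)
    rw [← hb] at h
    have h' : (cycleDist b' (b + ((t * (i / t) : ℤ) : ZMod q)) : ℝ) ≤ t - 1 := by
      have : (cycleDist b' (b + ((t * (i / t) : ℤ) : ZMod q)) : ℤ) ≤ t - 1 := by omega
      exact_mod_cast this
    linarith

/-- A point is within W ≤ r/2 of the root of its piece, which is within r/2 of a net of roots; this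
is why the cycle net has precision ρ/2. -/
lemma exists_glue_net_of_le (hY : ∀ b y, dist y (Y b).root ≤ W) (x : (glue Y hW).carrier) {r : ℝ}
    (hr : 2 * W ≤ r) : ∃ s : Finset (glue Y hW).carrier, s.card ≤ 8 ∧
      ∀ y, dist y x ≤ 2 * r → ∃ z ∈ s, dist y z ≤ r := by
  classical
  obtain ⟨b, x, rfl⟩ := glue_cases Y hW x
  obtain ⟨s, hs, hsr⟩ := exists_cycle_net b (ρ := r / W)
    (div_nonneg (by linarith) hW.le)
  refine ⟨s.image fun c => glueMk Y hW c (Y c).root, Finset.card_image_le.trans hs,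
    fun y hy => ?_⟩
  obtain ⟨b', y, rfl⟩ := glue_cases Y hW y
  have h := (le_dist_glueMk hW b' b y x).trans hy
  obtain ⟨c, hc, hcr⟩ := hsr b' (by rw [← mul_div_assoc, le_div_iff₀ hW]; linarith)
  refine ⟨_, Finset.mem_image_of_mem _ hc, (dist_glueMk_le ..).trans ?_⟩
  rw [le_div_iff₀ hW] at hcr
  rw [dist_self]
  linarith [hY b' y]

/-- Three scales. For r ≥ 2W roots suffice as centres; for 2r < W the ball stays inside one piece.
In between, at most 8 pieces are met and each is covered by 8 balls of radius W/2 ≤ r, whence 64.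
The constant therefore does not grow under repeated gluing. -/
lemma glue_isDoublingWith (hY : ∀ b y, dist y (Y b).root ≤ W)
    (hcov : ∀ b, ∃ s : Finset (Y b).carrier, s.card ≤ 8 ∧ ∀ y, ∃ z ∈ s, dist y z ≤ W / 2)
    (hdoub : ∀ b, IsDoublingWith (Y b).carrier 64) : IsDoublingWith (glue Y hW).carrier 64 := by
  classical
  intro x r hr
  simp only [Set.subset_def, Metric.mem_closedBall, Set.mem_iUnion, exists_prop]
  rcases le_or_gt (2 * W) r with hrW | hrW
  · obtain ⟨s, hs, h⟩ := exists_glue_net_of_le hW hY x hrW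
    exact ⟨s, hs.trans (by norm_num), h⟩
  obtain ⟨b, x, rfl⟩ := glue_cases Y hW x
  rcases lt_or_ge (2 * r) W with hrW' | hrW'
  · obtain ⟨s, hs, h⟩ := hdoub b x r hr
    refine ⟨s.image (glueMk Y hW b), Finset.card_image_le.trans hs, fun y hy => ?_⟩
    obtain ⟨b', y, rfl⟩ := glue_cases Y hW y
    obtain rfl : b' = b := by
      by_contra hb
      have h₁ : (1 : ℝ) ≤ cycleDist b' b := by exact_mod_cast one_le_cycleDist hb
      have h₂ := le_dist_glueMk hW b' b y x
      nlinarith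
    rw [dist_glueMk_same] at hy
    obtain ⟨z, hz, hz'⟩ := Set.mem_iUnion₂.1 (h (Metric.mem_closedBall.2 hy))
    exact ⟨_, Finset.mem_image_of_mem _ hz, by rwa [dist_glueMk_same]⟩
  · obtain ⟨s, hs, hsr⟩ := exists_cycle_net b (ρ := r / W) (by positivity)
    choose t ht ht' using hcov
    refine ⟨s.biUnion fun c => (t c).image (glueMk Y hW c), ?_, fun y hy => ?_⟩
    · refine (Finset.card_biUnion_le_card_mul _ _ 8
        fun c _ => Finset.card_image_le.trans (ht c)).trans ?_
      omega
    · obtain ⟨b', y, rfl⟩ := glue_cases Y hW y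
      have h := (le_dist_glueMk hW b' b y x).trans hy
      obtain ⟨c, hc, hcr⟩ := hsr b' (by rw [← mul_div_assoc, le_div_iff₀ hW]; linarith)
      rw [le_div_iff₀ hW] at hcr
      -- Here ρ < 2, so a net vertex at distance at most ρ/2 < 1 is the vertex itself.
      obtain rfl : b' = c := by
        by_contra hb
        have h₁ : (1 : ℝ) ≤ cycleDist b' c := by exact_mod_cast one_le_cycleDist hb
        nlinarith
      obtain ⟨z, hz, hz'⟩ := ht' b' y
      refine ⟨_, Finset.mem_biUnion.2 ⟨b', hc, Finset.mem_image_of_mem _ hz⟩, ?_⟩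
      rw [dist_glueMk_same]
      linarith

end Glue

/-! ### Geodesic noncrossing graphs -/

/-- The weight of an edge is the distance of its endpoints. -/
noncomputable def distWeight {X : Type*} [MetricSpace X] (e : Sym2 X) : ℝ :=
  Sym2.lift ⟨fun x y : X => dist x y, dist_comm⟩ e

/-- The graph contains a walk between `x` and `y` whose length is their distance. -/
def HasGeodesic {X : Type*} [MetricSpace X] (G : SimpleGraph X) (x y : X) : Prop :=
  ∃ p : G.Walk x y, walkLength distWeight p = dist x y

section Geodesic

variable {X : Type*} [MetricSpace X] {G : SimpleGraph X}

lemma dist_le_walkLength {x y : X} (p : G.Walk x y) : dist x y ≤ walkLength distWeight p := by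
  induction p with
  | nil => simp [walkLength]
  | @cons u v w h p ih =>
    have hcons : walkLength distWeight (SimpleGraph.Walk.cons h p)
        = dist u v + walkLength distWeight p := by
      simp [walkLength, distWeight]
    rw [hcons]
    linarith [dist_triangle u v w]

lemma HasGeodesic.refl (x : X) : HasGeodesic G x x := ⟨.nil, by simp [walkLength]⟩

lemma HasGeodesic.of_adj {x y : X} (h : G.Adj x y) : HasGeodesic G x y :=
  ⟨h.toWalk, by simp [walkLength, distWeight]⟩

lemma HasGeodesic.trans {x y z : X} (h : HasGeodesic G x y) (h' : HasGeodesic G y z)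
    (hd : dist x z = dist x y + dist y z) : HasGeodesic G x z := by
  obtain ⟨p, hp⟩ := h
  obtain ⟨p', hp'⟩ := h'
  exact ⟨p.append p', by rw [walkLength_append, hp, hp', hd]⟩

lemma HasGeodesic.symm {x y : X} (h : HasGeodesic G x y) : HasGeodesic G y x := by
  obtain ⟨p, hp⟩ := h
  exact ⟨p.reverse, by rw [walkLength_reverse, hp, dist_comm]⟩

lemma HasGeodesic.map {X' : Type*} [MetricSpace X'] {G' : SimpleGraph X'}
    (f : G →g G') (hf : ∀ x y, dist (f x) (f y) = dist x y) {x y : X} (h : HasGeodesic G x y) :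
    HasGeodesic G' (f x) (f y) := by
  obtain ⟨p, hp⟩ := h
  refine ⟨p.map f, ?_⟩
  rw [hf, ← hp, walkLength, walkLength, SimpleGraph.Walk.edges_map, List.map_map]
  congr 1
  refine List.map_congr_left fun e _ => ?_
  induction e using Sym2.ind with
  | _ u v => exact hf u v

end Geodesic

/-- The metric is the path metric of a graph that is noncrossing for a numbering starting at the
root. -/
def PointedSpace.IsOuterplanar (Y : PointedSpace) : Prop :=
  ∃ (G : SimpleGraph Y.carrier) (h : Y.carrier → ℕ), Function.Injective h ∧ h Y.root = 0 ∧
    G.IsNoncrossing h ∧ ∀ x y, HasGeodesic G x y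

theorem PointedSpace.IsOuterplanar.isPlanarMetric {Y : PointedSpace} (hY : Y.IsOuterplanar) :
    IsPlanarMetric Y.carrier := by
  obtain ⟨G, h, hinj, -, hG, hgeo⟩ := hY
  refine ⟨G, distWeight, hG.isPlanarGraph hinj, fun e he => ?_, fun x y => ⟨hgeo x y, ?_⟩⟩
  · induction e using Sym2.ind with
    | _ u v => exact dist_pos.2 (SimpleGraph.Adj.ne he)
  · rintro _ ⟨p, rfl⟩
    exact dist_le_walkLength p

/-! ### The graph of a glued space: geodesics and noncrossing numbering -/

section Glue

variable {q : ℕ} [NeZero q] {W : ℝ} {Y : ZMod q → PointedSpace} (hW : 0 < W)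

/-- The edges of a glued space: those of its pieces and those of the cycle. -/
inductive GlueRel (G : ∀ b, SimpleGraph (Y b).carrier) :
    (glue Y hW).carrier → (glue Y hW).carrier → Prop
  | piece (b : ZMod q) (x y : (Y b).carrier) (h : (G b).Adj x y) :
      GlueRel G (glueMk Y hW b x) (glueMk Y hW b y)
  | cycle (b : ZMod q) :
      GlueRel G (glueMk Y hW b (Y b).root) (glueMk Y hW (b + 1) (Y (b + 1)).root)

/-- The graph of a glued space. -/
def glueGraph (G : ∀ b, SimpleGraph (Y b).carrier) : SimpleGraph (glue Y hW).carrier :=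
  SimpleGraph.fromRel (GlueRel hW G)

variable {G : ∀ b, SimpleGraph (Y b).carrier}

lemma glueGraph_adj_cases {x y : (glue Y hW).carrier} (h : (glueGraph hW G).Adj x y) :
    (∃ b u v, (G b).Adj u v ∧ x = glueMk Y hW b u ∧ y = glueMk Y hW b v) ∨
    ∃ a b, (b = a + 1 ∨ a = b + 1) ∧
      x = glueMk Y hW a (Y a).root ∧ y = glueMk Y hW b (Y b).root := by
  obtain ⟨-, h | h⟩ := (SimpleGraph.fromRel_adj _ _ _).1 h
  · cases h with
    | piece b u v huv => exact Or.inl ⟨b, u, v, huv, rfl, rfl⟩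
    | cycle b => exact Or.inr ⟨b, b + 1, Or.inl rfl, rfl, rfl⟩
  · cases h with
    | piece b u v huv => exact Or.inl ⟨b, v, u, huv.symm, rfl, rfl⟩
    | cycle b => exact Or.inr ⟨b + 1, b, Or.inr rfl, rfl, rfl⟩

/-- The inclusion of a piece into a glued space as a map of graphs. -/
def glueHom (G : ∀ b, SimpleGraph (Y b).carrier) (b : ZMod q) : G b →g glueGraph hW G where
  toFun := glueMk Y hW b
  map_rel' {x y} h := (SimpleGraph.fromRel_adj _ _ _).2
    ⟨fun e => h.ne (glueMk_injective Y hW b e), Or.inl (.piece b x y h)⟩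

/-- Walk along the arc: since it is at most half of the cycle, the distance from a grows by W at
each step. -/
lemma glueGraph_hasGeodesic_add_natCast (a : ZMod q) {j : ℕ} (hj : 2 * j ≤ q) {b : ZMod q}
    (hb : b = a + (j : ZMod q)) :
    HasGeodesic (glueGraph hW G) (glueMk Y hW b (Y b).root) (glueMk Y hW a (Y a).root) := by
  induction j generalizing b with
  | zero =>
    obtain rfl : b = a := by simpa using hb
    exact HasGeodesic.refl _
  | succ j ih =>
    obtain ⟨c, hc⟩ : ∃ c, c = a + (j : ZMod q) := ⟨_, rfl⟩
    have h₁ := cycleDist_add_natCast a hj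
    have h₂ := cycleDist_add_natCast (j := j) a (by omega)
    have h₃ := cycleDist_add_natCast (j := 1) c (by omega)
    obtain rfl : b = c + 1 := by rw [hb, hc]; push_cast; ring
    rw [← hb] at h₁
    rw [← hc] at h₂
    rw [Nat.cast_one] at h₃
    have hadj : (glueGraph hW G).Adj (glueMk Y hW c (Y c).root)
        (glueMk Y hW (c + 1) (Y (c + 1)).root) := by
      refine (SimpleGraph.fromRel_adj _ _ _).2 ⟨fun e => ?_, Or.inl (.cycle _)⟩
      have e : c = c + 1 := congrArg Sigma.fst e
      rw [← e] at h₃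
      simp at h₃
    refine (HasGeodesic.of_adj hadj.symm).trans (ih (by omega) hc) ?_
    rw [dist_glueMk_root, dist_glueMk_root, dist_glueMk_root, h₁, h₂, h₃]
    push_cast
    ring

lemma glueGraph_hasGeodesic_root (a b : ZMod q) :
    HasGeodesic (glueGraph hW G) (glueMk Y hW a (Y a).root) (glueMk Y hW b (Y b).root) := by
  have hle := two_mul_cycleDist_le a b
  have hab : a = b + ((a - b).valMinAbs : ZMod q) := by
    rw [ZMod.coe_valMinAbs]; ring
  rw [cycleDist] at hle
  rcases Int.natAbs_eq (a - b).valMinAbs with h | h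
  · rw [h, Int.cast_natCast] at hab
    exact glueGraph_hasGeodesic_add_natCast hW b hle hab
  · rw [h, Int.cast_neg, Int.cast_natCast] at hab
    exact (glueGraph_hasGeodesic_add_natCast hW a hle (by linear_combination -hab)).symm

lemma glueGraph_hasGeodesic (hG : ∀ b x y, HasGeodesic (G b) x y) (x y : (glue Y hW).carrier) :
    HasGeodesic (glueGraph hW G) x y := by
  obtain ⟨a, x, rfl⟩ := glue_cases Y hW x
  obtain ⟨b, y, rfl⟩ := glue_cases Y hW y
  have hin : ∀ b x y, HasGeodesic (glueGraph hW G) (glueMk Y hW b x) (glueMk Y hW b y) :=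
    fun b x y => (hG b x y).map (glueHom hW G b) (dist_glueMk_same hW b)
  by_cases h : a = b
  · subst h
    exact hin a x y
  · refine ((hin a x (Y a).root).trans (glueGraph_hasGeodesic_root hW a b) ?_).trans
      (hin b (Y b).root y) ?_ <;> simp [dist_glueMk_of_ne hW h]

lemma le_of_mul_add_le {N i j u v : ℕ} (hv : v < N) (h : i * N + u ≤ j * N + v) : i ≤ j := by
  by_contra! hij
  have := Nat.mul_le_mul_right N (Nat.succ_le_of_lt hij)
  rw [Nat.succ_mul] at this
  omega

lemma ZMod.val_add_one_cases (a : ZMod q) :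
    (a + 1).val = a.val + 1 ∨ (a + 1).val = 0 ∧ a.val + 1 = q := by
  have h : (a + 1).val = (a.val + 1) % q := by
    rw [ZMod.val_add, ZMod.val_one_eq_one_mod, Nat.add_mod_mod]
  have := a.val_lt
  rcases Nat.lt_or_ge (a.val + 1) q with hlt | hge
  · exact Or.inl (h.trans (Nat.mod_eq_of_lt hlt))
  · have : a.val + 1 = q := by omega
    exact Or.inr ⟨by rw [h, this, Nat.mod_self], this⟩

/-- The pieces are numbered in consecutive blocks of size N, each starting with its root.
Interleaving edges of pieces would lie in the same block. An edge of the cycle cannot interleave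
with one of a piece, because a root is never strictly between two points of its own block. -/
theorem glue_isOuterplanar (hY : ∀ b, (Y b).IsOuterplanar) : (glue Y hW).IsOuterplanar := by
  choose G h hinj hroot hG hgeo using hY
  obtain ⟨N, hN⟩ : ∃ N, ∀ b y, h b y < N := by
    refine ⟨∑ b, ∑ y, h b y + 1, fun b y => Nat.lt_succ_of_le ?_⟩
    exact (Finset.single_le_sum (f := h b) (fun _ _ => Nat.zero_le _) (Finset.mem_univ y)).trans
      (Finset.single_le_sum (f := fun b => ∑ y, h b y) (fun _ _ => Nat.zero_le _)
        (Finset.mem_univ b))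
  let H : (glue Y hW).carrier → ℕ := fun x => x.1.val * N + h x.1 x.2
  have hH : ∀ b y, H (glueMk Y hW b y) = b.val * N + h b y := fun _ _ => rfl
  have hle : ∀ {a b x y}, H (glueMk Y hW a x) < H (glueMk Y hW b y) → a.val ≤ b.val :=
    fun hlt => le_of_mul_add_le (hN _ _) hlt.le
  refine ⟨glueGraph hW G, H, ?_, ?_, ?_, glueGraph_hasGeodesic hW hgeo⟩
  · intro x y hxy
    obtain ⟨a, x, rfl⟩ := glue_cases Y hW x
    obtain ⟨b, y, rfl⟩ := glue_cases Y hW y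
    rw [hH, hH] at hxy
    have hab : a.val = b.val :=
      le_antisymm (le_of_mul_add_le (hN b y) hxy.le) (le_of_mul_add_le (hN a x) hxy.ge)
    obtain rfl := ZMod.val_injective q hab
    have : h a x = h a y := by omega
    rw [hinj a this]
  · change (0 : ZMod q).val * N + h 0 (Y 0).root = 0
    rw [hroot, ZMod.val_zero, zero_mul]
  · intro a b c d hac hbd hab hbc hcd
    rcases glueGraph_adj_cases hW hac with ⟨i, x, y, hxy, rfl, rfl⟩ | ⟨i, j, hij, rfl, rfl⟩
    · rcases glueGraph_adj_cases hW hbd with ⟨k, u, v, huv, rfl, rfl⟩ | ⟨k, l, hkl, rfl, rfl⟩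
      · obtain rfl := ZMod.val_injective q (le_antisymm (hle hab) (hle hbc))
        simp only [hH] at hab hbc hcd
        exact hG i x u y v hxy huv (by omega) (by omega) (by omega)
      · obtain rfl := ZMod.val_injective q (le_antisymm (hle hab) (hle hbc))
        simp only [hH, hroot] at hab
        omega
    · rcases glueGraph_adj_cases hW hbd with ⟨k, u, v, huv, rfl, rfl⟩ | ⟨k, l, hkl, rfl, rfl⟩
      · obtain rfl := ZMod.val_injective q (le_antisymm (hle hbc) (hle hcd))
        simp only [hH, hroot] at hbc
        omega
      · simp only [hH, hroot, add_zero] at hab hbc hcd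
        have h₁ := Nat.lt_of_mul_lt_mul_right hab
        have h₂ := Nat.lt_of_mul_lt_mul_right hbc
        have h₃ := Nat.lt_of_mul_lt_mul_right hcd
        have := l.val_lt
        -- Cycle edges join consecutive blocks or the first and the last one, so no two of them
        -- interleave.
        rcases hij with rfl | rfl
        · rcases ZMod.val_add_one_cases i with h | h <;> omega
        · rcases ZMod.val_add_one_cases j with h | h <;> omega

end Glue

/-! ### Ramsey tree covers -/

/-- The same tree, seen as a tree containing a subset of the points. -/
def WeightedTree.comap {X X' : Type*} (T : WeightedTree X) (f : X' ↪ X) : WeightedTree X' :=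
  { T with point := f.trans T.point }

/-- At most `M` points have distortion at most `α` in a dominating tree. -/
def RamseyBound (X : Type*) [MetricSpace X] (α : ℝ) (M : ℕ) : Prop :=
  ∀ T : WeightedTree X, T.IsDominating → ∀ S : Finset X,
    (∀ u ∈ S, ∀ v, T.treeDist u v ≤ α * dist u v) → S.card ≤ M

/-- A Ramsey tree cover of `X` covers all points of an isometrically embedded space `Z`. -/
lemma RamseyBound.card_le {X Z : Type*} [MetricSpace X] [MetricSpace Z] [Fintype Z] {α : ℝ} {M : ℕ}
    (hZ : RamseyBound Z α M) {f : Z ↪ X} (hf : ∀ x y, dist (f x) (f y) = dist x y) {k : ℕ}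
    {T : Fin k → WeightedTree X} (hT : IsRamseyTreeCover α T) : Fintype.card Z ≤ k * M := by
  classical
  obtain ⟨hdom, hgood⟩ := hT
  let S : Fin k → Finset Z := fun i =>
    Finset.univ.filter fun u => ∀ v, (T i).treeDist (f u) (f v) ≤ α * dist u v
  have hS : ∀ i, (S i).card ≤ M := by
    refine fun i => hZ ((T i).comap f) (fun x y => ?_) _ fun u hu => (Finset.mem_filter.1 hu).2
    rw [← hf]
    exact hdom i _ _
  have huniv : (Finset.univ : Finset Z) ⊆ Finset.univ.biUnion S := by
    intro u _
    obtain ⟨i, hi⟩ := hgood (f u)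
    refine Finset.mem_biUnion.2 ⟨i, Finset.mem_univ i, Finset.mem_filter.2
      ⟨Finset.mem_univ u, fun v => ?_⟩⟩
    rw [← hf]
    exact hi _
  calc Fintype.card Z ≤ (Finset.univ.biUnion S).card := Finset.card_le_card huniv
    _ ≤ Finset.card (Finset.univ : Finset (Fin k)) * M :=
      Finset.card_biUnion_le_card_mul _ _ _ fun i _ => hS i
    _ = k * M := by rw [Finset.card_univ, Fintype.card_fin]

section Glue

variable {q : ℕ} [NeZero q] {W : ℝ} {Y : ZMod q → PointedSpace} (hW : 0 < W)

/-- In a dominating tree, the points of low distortion miss a piece of a glued space. -/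
lemma exists_piece_without_good_points {α R : ℝ} (hα : 0 ≤ α) (hR : ∀ b y, dist y (Y b).root ≤ R)
    (hq : 3 * (α * (1 + 2 * (R / W)) + 1) < q) {T : WeightedTree (glue Y hW).carrier}
    (hT : T.IsDominating) {S : Set (glue Y hW).carrier}
    (hS : ∀ u ∈ S, ∀ v, T.treeDist u v ≤ α * dist u v) : ∃ b, ∀ y, glueMk Y hW b y ∉ S := by
  by_contra! hcon
  choose u hu using hcon
  -- Chosen points of neighbouring pieces are within W + 2R, so β = α(1 + 2R/W).
  refine no_low_distortion_cycle T.isTree T.weight_nonneg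
    (fun b => T.point (glueMk Y hW b (u b))) hW hq (fun b => ?_) fun a b => ?_
  · refine (hS _ (hu b) _).trans ?_
    rw [mul_assoc]
    refine mul_le_mul_of_nonneg_left ((dist_glueMk_le ..).trans ?_) hα
    have h₁ : (cycleDist b (b + 1) : ℝ) ≤ 1 := by
      rw [cycleDist_comm]
      exact_mod_cast cycleDist_add_one_le b
    have h₂ := hR b (u b)
    have h₃ := hR (b + 1) (u (b + 1))
    rw [dist_comm] at h₃
    have h₄ : (1 + 2 * (R / W)) * W = W + 2 * R := by field_simp
    rw [h₄]
    nlinarith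
  · exact (le_dist_glueMk ..).trans (hT _ _)

end Glue

/-! ### The hard spaces -/

/-- The one-point space. -/
noncomputable def onePoint : PointedSpace := ⟨Unit, inferInstance, inferInstance, ()⟩

/-- The hierarchy of cycles of length `m`. -/
noncomputable def cycleTower (m : ℕ) [NeZero m] : ℕ → PointedSpace
  | 0 => onePoint
  | l + 1 => glue (fun _ : ZMod m => cycleTower m l) (W := (m : ℝ) ^ l)
      (pow_pos (Nat.cast_pos.2 (NeZero.pos m)) l)

/-- The properties of a pointed space that let it be glued to a cycle with edge length `W`. -/
structure PointedSpace.IsPiece (Y : PointedSpace) (W : ℝ) : Prop where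
  radius_le : ∀ y, dist y Y.root ≤ W
  cover : ∃ s : Finset Y.carrier, s.card ≤ 8 ∧ ∀ y, ∃ z ∈ s, dist y z ≤ W / 2
  doubling : IsDoublingWith Y.carrier 64
  outerplanar : Y.IsOuterplanar

lemma onePoint_isPiece {W : ℝ} (hW : 0 < W) : onePoint.IsPiece W := by
  have hd : ∀ x y : onePoint.carrier, dist x y = 0 := fun x y => dist_self ()
  refine ⟨fun y => (hd _ _).trans_le hW.le, ⟨{onePoint.root}, by simp, fun y =>
    ⟨_, Finset.mem_singleton_self _, (hd _ _).trans_le (by positivity)⟩⟩, fun x r hr =>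
    ⟨{onePoint.root}, by simp, fun y _ => ?_⟩, ⊥, fun _ => 0, fun _ _ _ => rfl, rfl, ?_, ?_⟩
  · simpa using (hd _ _).trans_le hr.le
  · intro a b c d h
    exact h.elim
  · exact fun x y => HasGeodesic.refl x

section Tower

variable {m : ℕ} [NeZero m]

lemma cycleTower_isPiece (hm : 4 ≤ m) (l : ℕ) : (cycleTower m l).IsPiece ((m : ℝ) ^ l) := by
  induction l with
  | zero => exact onePoint_isPiece (by simp)
  | succ l ih =>
    have hm' : (4 : ℝ) ≤ m := by exact_mod_cast hm
    have hW : (0 : ℝ) < (m : ℝ) ^ l := by positivity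
    have hrad := glue_radius_le (Y := fun _ : ZMod m => cycleTower m l) hW
      (fun _ => ih.radius_le) (by omega)
    refine ⟨hrad, ?_, glue_isDoublingWith hW (fun _ => ih.radius_le) (fun _ => ih.cover)
      fun _ => ih.doubling, glue_isOuterplanar hW fun _ => ih.outerplanar⟩
    -- The ball of radius 2r about the root is the whole space, and r ≥ 2m^l because m ≥ 4.
    obtain ⟨s, hs, h⟩ := exists_glue_net_of_le (Y := fun _ : ZMod m => cycleTower m l) hW
      (fun _ => ih.radius_le) (glue _ hW).root (r := (m : ℝ) ^ (l + 1) / 2)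
      (by rw [pow_succ]; nlinarith)
    refine ⟨s, hs, fun y => h y ((hrad y).trans ?_)⟩
    rw [pow_succ]
    linarith

lemma card_cycleTower (l : ℕ) : Fintype.card (cycleTower m l).carrier = m ^ l := by
  induction l with
  | zero => exact Fintype.card_unit
  | succ l ih =>
    refine (card_glue _).trans ?_
    rw [Finset.sum_const, ih, Finset.card_univ, ZMod.card, smul_eq_mul, pow_succ']

/-- The good points miss one copy. Restricted to any other copy the tree stays dominating and good
points stay good, so the induction multiplies the bound by m - 1. The factor 3α is α(1 + 2R/W) with
R = W. -/
lemma cycleTower_ramseyBound {α : ℝ} (hα : 0 ≤ α) (hm : 3 * (3 * α + 1) < m) (l : ℕ) :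
    RamseyBound (cycleTower m l).carrier α ((m - 1) ^ l) := by
  classical
  have hm4 : 4 ≤ m := by
    have : (3 : ℝ) < m := by linarith
    exact_mod_cast this
  induction l with
  | zero =>
    intro T _ S _
    exact S.card_le_univ.trans (card_cycleTower 0).le
  | succ l ih =>
    intro T hT S hS
    have hW : (0 : ℝ) < (m : ℝ) ^ l := pow_pos (Nat.cast_pos.2 (NeZero.pos m)) l
    obtain ⟨b₀, hb₀⟩ := exists_piece_without_good_points
      (Y := fun _ : ZMod m => cycleTower m l) hW (S := (S : Set (cycleTower m (l + 1)).carrier)) hα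
      (fun _ => (cycleTower_isPiece hm4 l).radius_le) (by rw [div_self hW.ne']; linarith) hT hS
    let f : ZMod m → (cycleTower m l).carrier → (cycleTower m (l + 1)).carrier :=
      glueMk (fun _ : ZMod m => cycleTower m l) hW
    have hsub : S ⊆ (Finset.univ.erase b₀).biUnion fun b =>
        (Finset.univ.filter fun y => f b y ∈ S).image (f b) := by
      intro x hx
      obtain ⟨b, y, rfl⟩ := glue_cases (fun _ : ZMod m => cycleTower m l) hW x
      refine Finset.mem_biUnion.2 ⟨b, Finset.mem_erase.2 ⟨?_, Finset.mem_univ b⟩,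
        Finset.mem_image_of_mem _ (Finset.mem_filter.2 ⟨Finset.mem_univ y, hx⟩)⟩
      rintro rfl
      exact hb₀ y hx
    refine (Finset.card_le_card hsub).trans
      ((Finset.card_biUnion_le_card_mul _ _ ((m - 1) ^ l) fun b _ => ?_).trans_eq ?_)
    · refine Finset.card_image_le.trans (ih (T.comap ⟨f b, glueMk_injective _ hW b⟩) ?_ _ ?_)
      · intro x y
        rw [← dist_glueMk_same (Y := fun _ : ZMod m => cycleTower m l) hW b]
        exact hT _ _
      · intro u hu v
        rw [← dist_glueMk_same (Y := fun _ : ZMod m => cycleTower m l) hW b]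
        exact hS _ (Finset.mem_filter.1 hu).2 _
    · rw [Finset.card_erase_of_mem (Finset.mem_univ _), Finset.card_univ, ZMod.card, pow_succ']

end Tower

/-! ### The size of a cover -/

/-- From α > 2 come m ≤ 11α and m ≤ α^5, so m ln m ≤ 55 α ln α. The remaining factor 2 of 110 pays
for the denominator 2m. -/
lemma rpow_le_exp_div {α : ℝ} (hα : 2 < α) {m n l : ℕ} (hm : (m : ℝ) ≤ 9 * α + 4) (hn : 1 ≤ n)
    (hnm : n < m ^ (l + 1)) :
    (n : ℝ) ^ (1 / 110 / (α * Real.log α)) ≤ Real.exp ((l + 1) / (2 * m)) := by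
  have hm0 : 0 < m := by
    rcases Nat.eq_zero_or_pos m with rfl | h
    · simp at hnm
    · exact h
  have hm0' : (0 : ℝ) < m := by exact_mod_cast hm0
  have hn0 : (0 : ℝ) < n := by exact_mod_cast hn
  have hα0 : 0 < α := by linarith
  have hlog : 0 < Real.log α := Real.log_pos (by linarith)
  have hlogm : Real.log m ≤ 5 * Real.log α := by
    have h : (m : ℝ) ≤ α ^ 5 := by
      have h4 : (2 : ℝ) ^ 4 ≤ α ^ 4 := pow_le_pow_left₀ (by norm_num) hα.le 4
      have : α ^ 5 = α ^ 4 * α := by ring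
      nlinarith
    calc Real.log m ≤ Real.log (α ^ 5) := Real.log_le_log hm0' h
      _ = 5 * Real.log α := by rw [Real.log_pow]; norm_num
  have hlogm0 : 0 ≤ Real.log m := Real.log_nonneg (by exact_mod_cast hm0)
  have hlogn : Real.log n ≤ (l + 1) * Real.log m := by
    calc Real.log n ≤ Real.log ((m : ℝ) ^ (l + 1)) :=
          Real.log_le_log hn0 (by exact_mod_cast hnm.le)
      _ = (l + 1) * Real.log m := by rw [Real.log_pow]; push_cast; ring
  have hmm : m * Real.log m ≤ 55 * (α * Real.log α) := by
    calc m * Real.log m ≤ (11 * α) * (5 * Real.log α) :=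
          mul_le_mul (by linarith) hlogm hlogm0 (by linarith)
      _ = 55 * (α * Real.log α) := by ring
  rw [Real.rpow_def_of_pos hn0, Real.exp_le_exp, div_div, mul_one_div,
    div_le_div_iff₀ (by positivity) (by positivity)]
  calc Real.log n * (2 * m) ≤ ((l + 1) * Real.log m) * (2 * m) :=
        mul_le_mul_of_nonneg_right hlogn (by positivity)
    _ = (l + 1) * (2 * (m * Real.log m)) := by ring
    _ ≤ (l + 1) * (110 * (α * Real.log α)) :=
        mul_le_mul_of_nonneg_left (by linarith) (by positivity)

/-- Since 1 - 1/m ≤ e^(-1/m), the hypothesis gives k ≥ e^(l/m), and l ≥ (l + 1)/2 for l ≥ 1. -/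
lemma exp_div_le_of_pow_le {m l k : ℕ} (hm : 2 ≤ m) (hl : 1 ≤ l) (hk : m ^ l ≤ k * (m - 1) ^ l) :
    Real.exp ((l + 1) / (2 * m)) ≤ k := by
  have hm' : (2 : ℝ) ≤ m := by exact_mod_cast hm
  have hl' : (1 : ℝ) ≤ l := by exact_mod_cast hl
  have hk' : (m : ℝ) ^ l ≤ k * (m - 1 : ℝ) ^ l := by
    have h : ((m ^ l : ℕ) : ℝ) ≤ ((k * (m - 1) ^ l : ℕ) : ℝ) := by exact_mod_cast hk
    push_cast [Nat.cast_sub (show 1 ≤ m by omega)] at h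
    exact h
  have h₁ : Real.exp (1 / m) * (m - 1 : ℝ) ≤ m := by
    have h := Real.add_one_le_exp (-(1 / m : ℝ))
    have h' : (m - 1 : ℝ) = m * (-(1 / m) + 1) := by field_simp; ring
    calc Real.exp (1 / m) * (m - 1 : ℝ) = m * (Real.exp (1 / m) * (-(1 / m) + 1)) := by
          rw [h']; ring
      _ ≤ m * (Real.exp (1 / m) * Real.exp (-(1 / m))) := by gcongr
      _ = m := by rw [← Real.exp_add]; simp
  have h₂ : Real.exp ((l + 1) / (2 * m)) ≤ Real.exp (1 / m) ^ l := by
    rw [← Real.exp_nat_mul, Real.exp_le_exp, mul_one_div, div_le_div_iff₀ (by positivity)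
      (by positivity)]
    nlinarith
  have h₃ : (0 : ℝ) < (m - 1 : ℝ) ^ l := pow_pos (by linarith) l
  refine h₂.trans (le_of_mul_le_mul_right ?_ h₃)
  rw [← mul_pow]
  exact (pow_le_pow_left₀ (mul_nonneg (Real.exp_pos _).le (by linarith)) h₁ l).trans hk'

lemma exp_div_le_two {m : ℕ} (hm : 1 ≤ m) : Real.exp (1 / (2 * m)) ≤ 2 := by
  have hm' : (1 : ℝ) ≤ m := by exact_mod_cast hm
  have h₁ : (1 / (2 * m) : ℝ) ≤ 1 / 2 :=
    one_div_le_one_div_of_le (by norm_num) (by linarith)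
  have h₂ := Real.add_one_le_exp (-(1 / (2 * m) : ℝ))
  have h₃ : Real.exp (1 / (2 * m)) * Real.exp (-(1 / (2 * m))) = 1 := by
    rw [← Real.exp_add]; simp
  have h₄ := Real.exp_pos (1 / (2 * m) : ℝ)
  nlinarith

theorem mainTheorem7 :
    ∃ (c D : ℝ), 0 < c ∧
      ∀ (n : ℕ) (α : ℝ), 2 < α → α < (n : ℝ) / 3 - 1 →
        ∃ (X : Type) (_ : MetricSpace X) (_ : Fintype X),
          Fintype.card X = n ∧ IsPlanarMetric X ∧ doublingDimension X ≤ D ∧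
          ∀ (k : ℕ) (T : Fin k → WeightedTree X), IsRamseyTreeCover α T →
            (n : ℝ) ^ (c / (α * Real.log α)) ≤ (k : ℝ) := by
  classical
  refine ⟨1 / 110, 6, by norm_num, fun n α hα hn => ?_⟩
  have hn0 : n ≠ 0 := by
    rintro rfl
    norm_num at hn
    linarith
  -- The least choice of this kind that guarantees m > 9α + 3 = 3(3α + 1).
  obtain ⟨m, hm⟩ : ∃ m, m = ⌊9 * α⌋₊ + 4 := ⟨_, rfl⟩
  have hm4 : 4 ≤ m := by omega
  have hmle : (m : ℝ) ≤ 9 * α + 4 := by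
    rw [hm]; push_cast
    linarith [Nat.floor_le (show 0 ≤ 9 * α by linarith)]
  have hmgt : 3 * (3 * α + 1) < (m : ℝ) := by
    rw [hm]; push_cast
    linarith [Nat.lt_floor_add_one (9 * α)]
  have : NeZero m := ⟨by omega⟩
  obtain ⟨l, hl⟩ : ∃ l, l = Nat.log m n := ⟨_, rfl⟩
  have hln : m ^ l ≤ n := hl ▸ Nat.pow_log_le_self m hn0
  have hnl : n < m ^ (l + 1) := hl ▸ Nat.lt_pow_succ_log_self (by omega) n
  have hml : 1 ≤ m ^ l := Nat.one_le_pow _ _ (by omega)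
  have hW : (0 : ℝ) < (m : ℝ) ^ l := by positivity
  -- The tower occupies vertex 0, so q - 1 single points bring the total to n.
  obtain ⟨q, hq⟩ : ∃ q, q = n - m ^ l + 1 := ⟨_, rfl⟩
  have : NeZero q := ⟨by omega⟩
  let Y : ZMod q → PointedSpace := fun b => if b = 0 then cycleTower m l else onePoint
  have hY0 : Y 0 = cycleTower m l := if_pos rfl
  have hY : ∀ b, (Y b).IsPiece ((m : ℝ) ^ l) := by
    intro b
    by_cases hb : b = 0
    · rw [show Y b = cycleTower m l from if_pos hb]
      exact cycleTower_isPiece hm4 l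
    · rw [show Y b = onePoint from if_neg hb]
      exact onePoint_isPiece hW
  have hcard0 : Fintype.card (Y 0).carrier = m ^ l := by rw [hY0, card_cycleTower]
  have hcard : Fintype.card (glue Y hW).carrier = n := by
    have h : ∀ b ∈ Finset.univ.erase (0 : ZMod q), Fintype.card (Y b).carrier = 1 := by
      intro b hb
      rw [show Y b = onePoint from if_neg (Finset.ne_of_mem_erase hb)]
      exact Fintype.card_unit
    rw [card_glue, ← Finset.add_sum_erase _ _ (Finset.mem_univ 0), Finset.sum_congr rfl h, hcard0,
      Finset.sum_const, Finset.card_erase_of_mem (Finset.mem_univ _), Finset.card_univ, ZMod.card,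
      smul_eq_mul]
    omega
  refine ⟨(glue Y hW).carrier, inferInstance, inferInstance, hcard,
    (glue_isOuterplanar hW fun b => (hY b).outerplanar).isPlanarMetric, ?_, fun k T hT => ?_⟩
  · have h : doublingConstant (glue Y hW).carrier ≤ 64 := Nat.sInf_le
      (glue_isDoublingWith hW (fun b => (hY b).radius_le) (fun b => (hY b).cover)
        fun b => (hY b).doubling)
    rw [doublingDimension]
    rcases Nat.eq_zero_or_pos (doublingConstant (glue Y hW).carrier) with h0 | h0
    · simp [h0]
    · rw [Real.logb_le_iff_le_rpow (by norm_num) (by exact_mod_cast h0)]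
      calc ((doublingConstant (glue Y hW).carrier : ℕ) : ℝ) ≤ 64 := by exact_mod_cast h
        _ = 2 ^ (6 : ℝ) := by norm_num
  · refine (rpow_le_exp_div hα hmle (Nat.one_le_iff_ne_zero.2 hn0) hnl).trans ?_
    -- For l = 0 the space is a bare n-cycle and the required bound is at most 2, so it is enough
    -- that one tree does not suffice.
    rcases Nat.eq_zero_or_pos l with rfl | hl0
    · have hk : 2 ≤ k := by
        by_contra! hk
        obtain ⟨hdom, hgood⟩ := hT
        have hsub : Subsingleton (Fin k) := Fin.subsingleton_iff_le_one.2 (by omega)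
        obtain ⟨i, -⟩ := hgood (glue Y hW).root
        have hall : ∀ u v, (T i).treeDist u v ≤ α * dist u v := by
          intro u
          obtain ⟨j, hj⟩ := hgood u
          rwa [Subsingleton.elim j i] at hj
        have hqn : (q : ℝ) = n := by
          rw [pow_zero] at hq
          exact_mod_cast (by omega : q = n)
        have hrad : ∀ b y, dist y (Y b).root ≤ 0 := by
          intro b
          have hb : Y b = onePoint := by
            change ite _ _ _ = _
            split_ifs <;> rfl
          rw [hb]
          exact fun y => (dist_self ()).le
        -- With R = 0 the length condition reads 3(α + 1) < n, which is exactly the hypothesis α <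
        -- n/3 - 1.
        obtain ⟨b, hb⟩ := exists_piece_without_good_points hW (S := Set.univ)
          (by linarith) hrad (by rw [zero_div, hqn]; linarith) (hdom i) fun u _ => hall u
        exact hb (Y b).root trivial
      calc Real.exp (((0 : ℕ) + 1) / (2 * m)) ≤ 2 := by
            simpa using exp_div_le_two (m := m) (by omega)
        _ ≤ (k : ℝ) := by exact_mod_cast hk
    · refine exp_div_le_of_pow_le (by omega) hl0 ?_
      have hbound : RamseyBound (Y 0).carrier α ((m - 1) ^ l) := by
        rw [hY0]
        exact cycleTower_ramseyBound (by linarith) hmgt l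
      rw [← hcard0]
      exact hbound.card_le (f := ⟨glueMk Y hW 0, glueMk_injective Y hW 0⟩)
        (dist_glueMk_same hW 0) hT
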